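/- Let $m,n\ge 0$ be integers and let $D_0,D_1,D_2$ be complex Hermitian $m\times m$ matrices such that the polynomial $$\Delta(x_0,x_1,x_2)=\det(x_0D_0+x_1D_1-x_2D_2)$$ is not identically zero (so that $\Delta=0$ is a plane algebraic curve of degree $m$, given by this determinantal representation). Let $$W_n=\{(w_i)_{i}: w_i\in\mathbb{C}^m,\ i=(i_0,i_1,i_2)\in\mathbb{Z}_{\ge 0}^3,\ i_0+i_1+i_2=n-1\}\cong\mathbb{C}^{m\,n(n+1)/2}$$ be the blown up space, and let the principal subspace $V_n\subseteq W_n$ consist of all $(w_i)\in W_n$ such that $$D_0w_{j+e_0}+D_1w_{j+e_1}-D_2w_{j+e_2}=0\quad\text{for all } j=(j_0,j_1,j_2)\in\mathbb{Z}_{\ge 0}^3\text{ with } j_0+j_1+j_2=n-2,$$ where $e_0,e_1,e_2$ are the standard unit vectors of $\mathbb{Z}^3$. Then $\dim_{\mathbb{C}}V_n=nm$. -/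

import Mathlib

namespace CurveElim

/-- The polynomial `Δ(x₀, x₁, x₂) = det (x₀ D₀ + x₁ D₁ - x₂ D₂)` in `ℂ[x₀, x₁, x₂]`. -/
noncomputable def discPoly {m : ℕ} (D₀ D₁ D₂ : Matrix (Fin m) (Fin m) ℂ) :
    MvPolynomial (Fin 3) ℂ :=
  Matrix.det
    ((MvPolynomial.X 0 : MvPolynomial (Fin 3) ℂ) • D₀.map MvPolynomial.C
      + (MvPolynomial.X 1 : MvPolynomial (Fin 3) ℂ) • D₁.map MvPolynomial.C
      - (MvPolynomial.X 2 : MvPolynomial (Fin 3) ℂ) • D₂.map MvPolynomial.C)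

/-- The multi-indices `i = (i₀, i₁, i₂)` of non-negative integers with `i₀ + i₁ + i₂ = n - 1`
(there are none when `n = 0`). -/
abbrev BlownIndex (n : ℕ) : Type := {i : Fin 3 →₀ ℕ // i.degree + 1 = n}

instance (n : ℕ) : Finite (BlownIndex n) :=
  ((Finsupp.finite_of_degree_le (σ := Fin 3) n).subset
    (fun i (hi : i.degree + 1 = n) => show i.degree ≤ n by omega)).to_subtype

/-- The blown up space `W_n`: families `(w_i)` of vectors of `ℂᵐ`, indexed by the multi-indices
`i` with `|i| = n - 1`. -/
abbrev BlownSpace (n m : ℕ) : Type := BlownIndex n → (Fin m → ℂ)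

/-- The multi-index `j + e_k`, where `|j| = n - 2`. -/
noncomputable def shift {n : ℕ} (j : Fin 3 →₀ ℕ) (hj : j.degree + 2 = n) (k : Fin 3) :
    BlownIndex n :=
  ⟨j + Finsupp.single k 1, by rw [map_add, Finsupp.degree_single]; omega⟩

/-- The principal subspace `V_n` of `W_n`: all `(w_i)` such that
`D₀ w_{j+e₀} + D₁ w_{j+e₁} - D₂ w_{j+e₂} = 0` for every `j` with `|j| = n - 2`. -/
def principalSubspace (n : ℕ) {m : ℕ} (D₀ D₁ D₂ : Matrix (Fin m) (Fin m) ℂ) :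
    Submodule ℂ (BlownSpace n m) where
  carrier := {w | ∀ (j : Fin 3 →₀ ℕ) (hj : j.degree + 2 = n),
    D₀.mulVec (w (shift j hj 0)) + D₁.mulVec (w (shift j hj 1))
      - D₂.mulVec (w (shift j hj 2)) = 0}
  zero_mem' := by
    intro j hj
    simp
  add_mem' := by
    intro v w hv hw j hj
    have h := congrArg₂ (· + ·) (hv j hj) (hw j hj)
    simp only [add_zero] at h
    rw [← h]
    simp only [Pi.add_apply, Matrix.mulVec_add]
    abel
  smul_mem' := by
    intro c w hw j hj
    have h := congrArg (c • ·) (hw j hj)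
    simp only [smul_zero] at h
    rw [← h]
    simp only [Pi.smul_apply, Matrix.mulVec_smul, smul_add, smul_sub]

end CurveElim

namespace CurveElim

open MvPolynomial
open scoped Matrix

/-! The space `V_{n+1}` is the kernel of a linear map `W_{n+1} → W_n`. A functional killing the
range encodes a row vector `p` of forms of degree `n - 1` with `p (x₀ D₀ + x₁ D₁ - x₂ D₂) = 0`;
since `Δ ≠ 0`, `p = 0`, so the map is onto. Rank-nullity leaves `m` times the increment `n + 1` in
the number of multi-indices. -/

theorem natCard_blownIndex (n : ℕ) : Nat.card (BlownIndex (n + 1)) = (n + 2).choose 2 := by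
  let e : BlownIndex (n + 1) ≃ {P : Fin 3 → ℕ // ∑ i, P i = n} :=
    Finsupp.equivFunOnFinite.subtypeEquiv fun i => by
      rw [Finsupp.degree_eq_sum]
      simp
  -- Stars and bars: the triples are multisets of size `n` on three letters.
  rw [Nat.card_congr (e.trans (Sym.equivNatSumOfFintype (Fin 3) n).symm),
    Nat.card_eq_fintype_card, Sym.card_sym_eq_choose, Fintype.card_fin,
    show 3 + n - 1 = n + 2 by omega, Nat.choose_symm_add]

theorem natCard_blownIndex_succ (n : ℕ) :
    Nat.card (BlownIndex (n + 1)) = Nat.card (BlownIndex n) + (n + 1) := by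
  cases n with
  | zero =>
    have : IsEmpty (BlownIndex 0) := ⟨fun i => by have := i.2; omega⟩
    simp [natCard_blownIndex]
  | succ k =>
    rw [natCard_blownIndex, natCard_blownIndex, Nat.choose_succ_succ' (k + 2) 1, Nat.choose_one_right]
    ring

/-- The linear map `W_{n+1} → W_n` whose kernel is the principal subspace, with the target written
in coordinates. -/
noncomputable def principalMap (n : ℕ) {m : ℕ} (D₀ D₁ D₂ : Matrix (Fin m) (Fin m) ℂ) :
    BlownSpace (n + 1) m →ₗ[ℂ] (BlownIndex n × Fin m → ℂ) where
  toFun w ja :=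
    (D₀.mulVec (w (shift ja.1.1 (congrArg Nat.succ ja.1.2) 0))
      + D₁.mulVec (w (shift ja.1.1 (congrArg Nat.succ ja.1.2) 1))
      - D₂.mulVec (w (shift ja.1.1 (congrArg Nat.succ ja.1.2) 2))) ja.2
  map_add' v w := by
    ext ja
    simp only [Pi.add_apply, Matrix.mulVec_add, Pi.sub_apply]
    ring
  map_smul' c w := by
    ext ja
    simp only [Pi.add_apply, Pi.smul_apply, Matrix.mulVec_smul, Pi.sub_apply, smul_eq_mul,
      RingHom.id_apply]
    ring

theorem ker_principalMap (n : ℕ) {m : ℕ} (D₀ D₁ D₂ : Matrix (Fin m) (Fin m) ℂ) :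
    LinearMap.ker (principalMap n D₀ D₁ D₂) = principalSubspace (n + 1) D₀ D₁ D₂ := by
  ext w
  constructor
  · intro hw j hj
    ext a
    exact congrFun hw (⟨j, Nat.succ.inj hj⟩, a)
  · intro hw
    ext ⟨j, a⟩
    exact congrFun (hw j.1 (congrArg Nat.succ j.2)) a

/-- A functional annihilating the range of the map amounts to a row vector of polynomials in the
left kernel of the pencil `x₀ D₀ + x₁ D₁ - x₂ D₂`, whose determinant does not vanish. -/
theorem principalMap_surjective (n : ℕ) {m : ℕ} (D₀ D₁ D₂ : Matrix (Fin m) (Fin m) ℂ)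
    (hΔ : discPoly D₀ D₁ D₂ ≠ 0) : Function.Surjective (principalMap n D₀ D₁ D₂) := by
  classical
  have := Fintype.ofFinite (BlownIndex n)
  rw [← LinearMap.range_eq_top]
  by_contra hne
  obtain ⟨f, hf, hle⟩ := Submodule.exists_le_ker_of_lt_top _ (lt_top_iff_ne_top.2 hne)
  set c : BlownIndex n → Fin m → ℂ := fun j a => f (Pi.single (j, a) 1) with hc
  have hfc (u) : f u = ∑ a, ∑ j, u (j, a) * c j a := by
    rw [LinearMap.pi_apply_eq_sum_univ f u, Fintype.sum_prod_type_right]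
    simp only [smul_eq_mul, hc]
    refine Finset.sum_congr rfl fun a _ => Finset.sum_congr rfl fun j _ => ?_
    congr 2
    ext x
    simp [Pi.single_apply, eq_comm]
  set p : Fin m → MvPolynomial (Fin 3) ℂ := fun a => ∑ j, monomial j.1 (c j a) with hp
  have hker : p ᵥ* ((X 0 : MvPolynomial (Fin 3) ℂ) • D₀.map C
      + (X 1 : MvPolynomial (Fin 3) ℂ) • D₁.map C
      - (X 2 : MvPolynomial (Fin 3) ℂ) • D₂.map C) = 0 := by
    ext b i
    have hcoeff (k : Fin 3) (z : ℂ) (a : Fin m) : coeff i (p a * (X k * C z))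
        = ∑ j, if j.1 + Finsupp.single k 1 = i then z * c j a else 0 := by
      rw [hp, Finset.sum_mul, coeff_sum]
      refine Finset.sum_congr rfl fun j _ => ?_
      rw [X, C_apply, monomial_mul, monomial_mul, coeff_monomial, add_zero, one_mul, mul_comm]
    -- Test vector: `b`-th basis vector at index `i`. Applying `f` to its image gives the
    -- `xⁱ`-coefficient of the `b`-th entry of `p` times the pencil. If `|i| ≠ n`, then `w = 0`.
    let w : BlownSpace (n + 1) m := fun l => if l.1 = i then Pi.single b 1 else 0
    have hw (D : Matrix (Fin m) (Fin m) ℂ) (l) (a) :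
        (D *ᵥ w l) a = if l.1 = i then D a b else 0 := by
      by_cases h : l.1 = i <;> simp [w, h]
    have hfw : f (principalMap n D₀ D₁ D₂ w) = 0 := hle ⟨w, rfl⟩
    rw [hfc] at hfw
    simp only [principalMap, LinearMap.coe_mk, AddHom.coe_mk, Pi.sub_apply, Pi.add_apply, hw, shift,
      sub_mul, add_mul, ite_mul, zero_mul] at hfw
    simp only [Matrix.vecMul, dotProduct, Matrix.sub_apply, Matrix.add_apply, Matrix.smul_apply,
      Matrix.map_apply, smul_eq_mul, mul_sub, mul_add, coeff_sum, coeff_sub, coeff_add, hcoeff,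
      Pi.zero_apply, coeff_zero, ← Finset.sum_add_distrib, ← Finset.sum_sub_distrib]
    exact hfw
  have hp0 := Matrix.eq_zero_of_vecMul_eq_zero hΔ hker
  refine hf (LinearMap.ext fun u => ?_)
  rw [hfc, LinearMap.zero_apply]
  refine Finset.sum_eq_zero fun a _ => Finset.sum_eq_zero fun j _ => ?_
  have h : coeff j.1 (p a) = 0 := by rw [hp0]; simp
  -- Distinct indices give distinct monomials, so `p` determines `c`.
  have : c j a = 0 := by simpa [hp, coeff_sum, coeff_monomial, Subtype.ext_iff.symm] using h
  rw [this, mul_zero]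

end CurveElim

theorem theorem2p4 (m n : ℕ) (D₀ D₁ D₂ : Matrix (Fin m) (Fin m) ℂ)
    (h₀ : D₀.IsHermitian) (h₁ : D₁.IsHermitian) (h₂ : D₂.IsHermitian)
    (hΔ : CurveElim.discPoly D₀ D₁ D₂ ≠ 0) :
    Module.finrank ℂ (CurveElim.principalSubspace n D₀ D₁ D₂) = n * m := by
  open CurveElim in
  cases n with
  | zero =>
    have : IsEmpty (BlownIndex 0) := ⟨fun i => by have := i.2; omega⟩
    rw [zero_mul]
    exact Module.finrank_zero_of_subsingleton
  | succ n =>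
    have := Fintype.ofFinite (BlownIndex n)
    have := Fintype.ofFinite (BlownIndex (n + 1))
    have h := (principalMap n D₀ D₁ D₂).finrank_range_add_finrank_ker
    rw [LinearMap.range_eq_top.2 (principalMap_surjective n D₀ D₁ D₂ hΔ), finrank_top,
      ker_principalMap, Module.finrank_fintype_fun_eq_card, Module.finrank_pi_fintype] at h
    have hcard := natCard_blownIndex_succ n
    simp only [Nat.card_eq_fintype_card] at hcard
    simp only [Fintype.card_prod, Fintype.card_fin, Module.finrank_fintype_fun_eq_card,
      Finset.sum_const, Finset.card_univ, smul_eq_mul, hcard] at h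
    linarith
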